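/- **Setting.** Let $\mathbb N=\{1,2,\dots\}$. Consider $x(k+1)=f(x(k),u(k))$ with constraints $x(k)\in\mathbb X\subset\mathbb R^n$, $u(k)\in\mathbb U\subset\mathbb R^m$, a stage cost $\ell:\mathbb X\times\mathbb U\to\mathbb R$, and a terminal cost $V_{\mathrm f}:\mathbb X_{\mathrm f}\to\mathbb R$ on a terminal region $\mathbb X_{\mathrm f}\subseteq\mathbb X$. Write $x_u(k,x)$ for the state at time $k$ starting from $x$ under the input sequence $u$. Let $\mathbb U^N(x)$ be the set of $u\in\mathbb U^N$ with $x_u(k,x)\in\mathbb X$ for $0\le k\le N$, and $\mathbb U^\infty(x)$ the set of infinite sequences $u$ in $\mathbb U$ with $x_u(k,x)\in\mathbb X$ for all $k\ge 0$. Let $$J_N(x,u)=\sum_{k=0}^{N-1}\ell(x_u(k,x),u(k))+V_{\mathrm f}(x_u(N,x)),\qquad V_N(x)=\inf\{J_N(x,u): u\in\mathbb U^N(x),\ x_u(N,x)\in\mathbb X_{\mathrm f}\},$$ and let $\mathbb X_N$ be the set of $x\in\mathbb X$ for which some $u\in\mathbb U^N(x)$ has $x_u(N,x)\in\mathbb X_{\mathrm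 f}$. An optimal feedback law $\mu_N$ assigns to each $x\in\mathbb X_N$ the first element of a minimizer of the problem defining $V_N(x)$. With $J^1_K(x,u)=\sum_{k=0}^{K-1}\ell(x_u(k,x),u(k))$, define $$J^{\mathrm{ces}}_K(x,u)=\frac1K\sum_{j=0}^{K-1}J^1_{j+1}(x,u),\qquad J^{\mathrm{ces}}_\infty(x,u)=\limsup_{K\to\infty}J^{\mathrm{ces}}_K(x,u),\qquad V^{\mathrm{uc}}_\infty(x)=\inf_{u\in\mathbb U^\infty(x)}J^{\mathrm{ces}}_\infty(x,u)$$ (as extended real numbers), and let $J^{\mathrm{cl}}_\infty(x,\mu_N)$ be $J^{\mathrm{ces}}_\infty(x,u)$ for the input sequence $u$ generated by $\mu_N$ in closed loop from $x$. A $p$-periodic orbit ($p\in\mathbb N$) is a family $\varPi(i)=(\varPi_{\mathbb X}(i),\varPi_{\mathbb U}(i))\in\mathbb X\times\mathbb U$, $0\le i\le p-1$, with $\varPi_{\mathbb X}((i+1)\bmod p)=f(\varPi(i))$ for all $i$. It is minimal if $\varPi_{\mathbb X}$ is injective. Put $\ell_\varPi=\frac1p\sum_{i}\ell(\varPi(i))$,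 $V_{\varPi}=\frac1p\sum_i V_{\mathrm f}(\varPi_{\mathbb X}(i))$, $\|(x,u)\|_\varPi=\min_i\|(x,u)-\varPi(i)\|$ and $\|x\|_{\varPi_{\mathbb X}}=\min_i\|x-\varPi_{\mathbb X}(i)\|$. The orbit is optimal if $\ell_\varPi$ is the infimum of the average costs of all periodic orbits of all periods. $\mathcal K_\infty$ is the class of continuous, strictly increasing, unbounded $\alpha:[0,\infty)\to[0,\infty)$ with $\alpha(0)=0$; $\mathcal L$ is the class of continuous, monotonically decreasing $\delta:[0,\infty)\to[0,\infty)$ with limit $0$ at infinity. **Theorem (non-averaged performance).** Let $\varPi^\star$ be an optimal periodic orbit, and assume: 1. $\mathbb X\times\mathbb U$ is compact, $f$ and $\ell$ are continuous on $\mathbb X\times\mathbb U$, and $V_{\mathrm f}$ is continuous on $\mathbb X_{\mathrm f}$. 2. (Strict dissipativity) There are a continuous $\lambda:\mathbb X\to\mathbb R$ and $\alpha\in\mathcal K_\infty$ with $\ell(x,u)-\ell_{\varPi^\star}+\lambda(x)-\lambda(f(x,u))\ge\alpha(\|(x,u)\|_{\varPi^\star})$ for all $x\in\mathbb X$, $u\in\mathbb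 U^1(x)$. 3. (Terminal conditions) $\mathbb X_{\mathrm f}$ is compact and contains all $\varPi^\star_{\mathbb X}(i)$, and for every $x\in\mathbb X_{\mathrm f}$ there is $u\in\mathbb U^1(x)$ with $f(x,u)\in\mathbb X_{\mathrm f}$ and $V_{\mathrm f}(x)\ge V_{\mathrm f}(f(x,u))+\ell(x,u)-\ell_{\varPi^\star}$. 4. (Bound on $V_N$) There is $\gamma_V\in\mathcal K_\infty$ such that for all $N\in\mathbb N$ and $x\in\mathbb X_N$, $|V_N(x)-V_N(\varPi^\star_{\mathbb X}(i_x))|\le\gamma_V(\|x\|_{\varPi^\star_{\mathbb X}})$, where $i_x$ is the index of a closest orbit state to $x$, i.e. $\|x-\varPi^\star_{\mathbb X}(i_x)\|=\|x\|_{\varPi^\star_{\mathbb X}}$. 5. (Minimality) $\varPi^\star$ is minimal. 6. (Feasibility close to $\varPi^\star$) There are $N_\eta\in\mathbb N$ and $\eta>0$ such that every $x\in\mathbb X$ with $\|x\|_{\varPi^\star_{\mathbb X}}\le\eta$ lies in $\mathbb X_{N_\eta}$. 7. $\ell_{\varPi^\star}=0$. Then there exists $\delta\in\mathcal L$ such that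 for all $N\in\mathbb N$, all $x\in\mathbb X_N$ and every optimal feedback law $\mu_N$, $$J^{\mathrm{cl}}_\infty(x,\mu_N)\le V_N(x)-V_{\varPi^\star}\le V^{\mathrm{uc}}_\infty(x)+\delta(N).$$ -/

import Mathlib

open Filter Topology Set

noncomputable section

namespace EMPC

/-- A function of class `K_∞`: continuous and strictly increasing on `[0, ∞)`, zero at zero and
unbounded. (Only the values on `[0, ∞)` matter; nonnegativity there follows.) -/
structure ClassKInf (α : ℝ → ℝ) : Prop where
  continuousOn : ContinuousOn α (Ici 0)
  map_zero : α 0 = 0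
  strictMonoOn : StrictMonoOn α (Ici 0)
  tendsto : Tendsto α atTop atTop

/-- A function of class `L`: continuous, nonnegative and monotonically decreasing on `[0, ∞)`, with
limit zero at infinity. -/
structure ClassL (δ : ℝ → ℝ) : Prop where
  continuousOn : ContinuousOn δ (Ici 0)
  nonneg : ∀ t, 0 ≤ t → 0 ≤ δ t
  antitoneOn : AntitoneOn δ (Ici 0)
  tendsto : Tendsto δ atTop (𝓝 0)

/-- The data of the control problem: state constraint set `X ⊆ ℝⁿ`, input constraint set `U ⊆ ℝᵐ`,
dynamics `f`, stage cost `ℓ`, terminal region `Xf` and terminal cost `Vf`. The functions are total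
for convenience; only the values of `f` and `ℓ` on `X × U` and of `Vf` on `Xf` are relevant. -/
structure Problem (n m : ℕ) where
  X : Set (EuclideanSpace ℝ (Fin n))
  U : Set (EuclideanSpace ℝ (Fin m))
  f : EuclideanSpace ℝ (Fin n) → EuclideanSpace ℝ (Fin m) → EuclideanSpace ℝ (Fin n)
  ℓ : EuclideanSpace ℝ (Fin n) → EuclideanSpace ℝ (Fin m) → ℝ
  Xf : Set (EuclideanSpace ℝ (Fin n))
  Vf : EuclideanSpace ℝ (Fin n) → ℝ

namespace Problem

variable {n m : ℕ} (S : Problem n m)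

/-- The state `x_u(k, x)` reached after `k` steps from `x` under the input sequence `u`; it depends
only on `u 0, …, u (k - 1)`. -/
def traj (x : EuclideanSpace ℝ (Fin n)) (u : ℕ → EuclideanSpace ℝ (Fin m)) :
    ℕ → EuclideanSpace ℝ (Fin n)
  | 0 => x
  | k + 1 => S.f (traj x u k) (u k)

/-- Feasible input sequences of length `N` from `x`. A sequence of length `N` is represented by the
first `N` entries of `u : ℕ → ℝᵐ`; the later entries are unconstrained and never used. -/
def inputs (N : ℕ) (x : EuclideanSpace ℝ (Fin n)) : Set (ℕ → EuclideanSpace ℝ (Fin m)) :=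
  {u | (∀ k < N, u k ∈ S.U) ∧ ∀ k ≤ N, S.traj x u k ∈ S.X}

/-- Feasible infinite input sequences from `x`. -/
def inputsInf (x : EuclideanSpace ℝ (Fin n)) : Set (ℕ → EuclideanSpace ℝ (Fin m)) :=
  {u | (∀ k, u k ∈ S.U) ∧ ∀ k, S.traj x u k ∈ S.X}

/-- Feasible input sequences of length `N` that also steer `x` into the terminal region. -/
def terminalInputs (N : ℕ) (x : EuclideanSpace ℝ (Fin n)) :
    Set (ℕ → EuclideanSpace ℝ (Fin m)) :=
  {u | u ∈ S.inputs N x ∧ S.traj x u N ∈ S.Xf}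

/-- The set `X_N` of feasible states. -/
def feasible (N : ℕ) : Set (EuclideanSpace ℝ (Fin n)) :=
  {x | x ∈ S.X ∧ (S.terminalInputs N x).Nonempty}

/-- The sum of the first `K` stage costs, `J¹_K(x, u)`. -/
def sumCost (K : ℕ) (x : EuclideanSpace ℝ (Fin n)) (u : ℕ → EuclideanSpace ℝ (Fin m)) : ℝ :=
  ∑ k ∈ Finset.range K, S.ℓ (S.traj x u k) (u k)

/-- The finite-horizon cost functional `J_N(x, u)` with terminal cost. -/
def cost (N : ℕ) (x : EuclideanSpace ℝ (Fin n)) (u : ℕ → EuclideanSpace ℝ (Fin m)) : ℝ :=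
  S.sumCost N x u + S.Vf (S.traj x u N)

/-- The optimal value function `V_N(x)`. -/
def value (N : ℕ) (x : EuclideanSpace ℝ (Fin n)) : ℝ :=
  sInf (S.cost N x '' S.terminalInputs N x)

/-- `μ` is an optimal feedback law `μ_N` for the horizon `N`: at every feasible state `x` it returns
the first element of some optimal input sequence. -/
def IsOptimalFeedback (N : ℕ) (μ : EuclideanSpace ℝ (Fin n) → EuclideanSpace ℝ (Fin m)) : Prop :=
  ∀ x ∈ S.feasible N, ∃ u ∈ S.terminalInputs N x, S.cost N x u = S.value N x ∧ μ x = u 0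

/-- The closed-loop state `x_μ(k, x)`. -/
def closedLoop (μ : EuclideanSpace ℝ (Fin n) → EuclideanSpace ℝ (Fin m))
    (x : EuclideanSpace ℝ (Fin n)) : ℕ → EuclideanSpace ℝ (Fin n)
  | 0 => x
  | k + 1 => S.f (closedLoop μ x k) (μ (closedLoop μ x k))

/-- The Cesàro cost `J^ces_K(x, u)`: the mean of the partial sums `J¹_1, …, J¹_K`. -/
def cesaroCost (K : ℕ) (x : EuclideanSpace ℝ (Fin n)) (u : ℕ → EuclideanSpace ℝ (Fin m)) : ℝ :=
  (1 / (K : ℝ)) * ∑ j ∈ Finset.range K, S.sumCost (j + 1) x u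

/-- The infinite-horizon Cesàro cost `J^ces_∞(x, u) = limsup_K J^ces_K(x, u)`, an extended real. -/
def cesaroCostInf (x : EuclideanSpace ℝ (Fin n)) (u : ℕ → EuclideanSpace ℝ (Fin m)) : EReal :=
  limsup (fun K : ℕ => (S.cesaroCost K x u : EReal)) atTop

/-- The infinite-horizon closed-loop cost `J^cl_∞(x, μ)`: the Cesàro cost of the input sequence
generated by the feedback `μ` along the closed loop started at `x`. -/
def closedLoopCostInf (x : EuclideanSpace ℝ (Fin n))
    (μ : EuclideanSpace ℝ (Fin n) → EuclideanSpace ℝ (Fin m)) : EReal :=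
  S.cesaroCostInf x (fun k => μ (S.closedLoop μ x k))

/-- The infinite-horizon unconditioned optimal cost `V^uc_∞(x)` (no terminal conditions). -/
def valueUncInf (x : EuclideanSpace ℝ (Fin n)) : EReal :=
  ⨅ u ∈ S.inputsInf x, S.cesaroCostInf x u

/-- A (feasible) `p`-periodic orbit; addition in `Fin p` is modulo `p`. -/
structure PeriodicOrbit (p : ℕ) [NeZero p] where
  x : Fin p → EuclideanSpace ℝ (Fin n)
  u : Fin p → EuclideanSpace ℝ (Fin m)
  x_mem : ∀ i, x i ∈ S.X
  u_mem : ∀ i, u i ∈ S.U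
  step : ∀ i, x (i + 1) = S.f (x i) (u i)

namespace PeriodicOrbit

variable {S} {p : ℕ} [NeZero p] (P : S.PeriodicOrbit p)

/-- The average stage cost `ℓ_Π`. -/
def avgCost : ℝ := (1 / (p : ℝ)) * ∑ i, S.ℓ (P.x i) (P.u i)

/-- The average terminal cost `V_Π`. -/
def avgTerminal : ℝ := (1 / (p : ℝ)) * ∑ i, S.Vf (P.x i)

/-- A periodic orbit is minimal if its states are pairwise distinct. -/
def IsMinimal : Prop := Function.Injective P.x

/-- A periodic orbit is optimal if its average cost is the infimum of the average costs of all
feasible periodic orbits of all periods (the infimum is then attained, by this orbit). -/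
def IsOptimal : Prop :=
  IsGLB {c : ℝ | ∃ (q : ℕ) (_ : NeZero q) (Q : S.PeriodicOrbit q), Q.avgCost = c} P.avgCost

/-- Euclidean distance of `(x, u)` to the orbit (a minimum over finitely many points). -/
def dist (x : EuclideanSpace ℝ (Fin n)) (u : EuclideanSpace ℝ (Fin m)) : ℝ :=
  ⨅ i, ‖WithLp.toLp 2 (x - P.x i, u - P.u i)‖

/-- Euclidean distance of `x` to the states of the orbit. -/
def distX (x : EuclideanSpace ℝ (Fin n)) : ℝ := ⨅ i, ‖x - P.x i‖

end PeriodicOrbit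

/-- Continuity and compactness. -/
structure ContComp : Prop where
  isCompact : IsCompact (S.X ×ˢ S.U)
  continuousOn_f : ContinuousOn (fun z : EuclideanSpace ℝ (Fin n) × EuclideanSpace ℝ (Fin m) =>
    S.f z.1 z.2) (S.X ×ˢ S.U)
  continuousOn_ℓ : ContinuousOn (fun z : EuclideanSpace ℝ (Fin n) × EuclideanSpace ℝ (Fin m) =>
    S.ℓ z.1 z.2) (S.X ×ˢ S.U)
  continuousOn_Vf : ContinuousOn S.Vf S.Xf

variable {S} {p : ℕ} [NeZero p] (P : S.PeriodicOrbit p)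

/-- Strict dissipativity with respect to the orbit. The pairs `(x, u)` range over `x ∈ X` and the
one-step feasible inputs `u ∈ U`, `f(x, u) ∈ X`. -/
def StrictDissipativity : Prop :=
  ∃ (lam : EuclideanSpace ℝ (Fin n) → ℝ) (α : ℝ → ℝ), ContinuousOn lam S.X ∧ ClassKInf α ∧
    ∀ x ∈ S.X, ∀ u ∈ S.U, S.f x u ∈ S.X →
      α (P.dist x u) ≤ S.ℓ x u - P.avgCost + lam x - lam (S.f x u)

/-- Terminal conditions. -/
structure TerminalConditions : Prop where
  isCompact : IsCompact S.Xf
  orbit_mem : ∀ i, P.x i ∈ S.Xf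
  subset : S.Xf ⊆ S.X
  exists_control : ∀ x ∈ S.Xf, ∃ u ∈ S.U, S.f x u ∈ S.X ∧ S.f x u ∈ S.Xf ∧
    S.Vf (S.f x u) + S.ℓ x u - P.avgCost ≤ S.Vf x

/-- Bound on the value functions near the orbit, uniformly in the horizon; the index `i` is that of
a closest orbit state to `x`. -/
def BoundValue : Prop :=
  ∃ γ : ℝ → ℝ, ClassKInf γ ∧ ∀ N : ℕ, 1 ≤ N → ∀ x ∈ S.feasible N,
    ∃ i, ‖x - P.x i‖ = P.distX x ∧ |S.value N x - S.value N (P.x i)| ≤ γ (P.distX x)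

/-- Feasibility close to the orbit. -/
def FeasibleNear : Prop :=
  ∃ (N : ℕ) (η : ℝ), 1 ≤ N ∧ 0 < η ∧ ∀ x ∈ S.X, P.distX x ≤ η → x ∈ S.feasible N

end Problem

end EMPC

end

namespace EMPC

/-! ### Comparison functions -/

namespace ClassKInf

variable {α : ℝ → ℝ}

/-! Adding λ(x) - λ(f(x,u)) to the stage cost makes it nonnegative, so the rotated sums `rotSum`
increase along every feasible trajectory. If they stay bounded, state and input approach the orbit
and, the orbit being minimal, follow it with a fixed phase (`exists_phase`). The leftover term
λ(x_K) may keep oscillating, but its mean tends to the orbit mean of λ. Hence the Cesàro cost is the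
limit of the rotated sums, minus λ(x), plus that mean. Phase locking under the terminal controller
also shows that V_f + λ takes one value c on the orbit and is at least c on X_f
(`rotTerminal_orbit_le`). So V_Π is c minus the same mean of λ; the means cancel, and both
inequalities compare rotated sums with V_N(x) + λ(x) - c. For the closed loop, V_N drops by at least
the stage cost at each step (`closedLoop_descent`), while V_N + λ never falls below c. For the
second inequality, V_N + λ - c is bounded uniformly in N and x. A competitor with smaller rotated
cost must therefore come near the orbit within a number of steps independent of x and u, and
finishing optimally from there costs about c - λ (`eventually_value_le_rotSum`). A competitor with
unbounded rotated cost has infinite Cesàro cost. -/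

lemma mono (h : ClassKInf α) {s t : ℝ} (hs : 0 ≤ s) (hst : s ≤ t) : α s ≤ α t :=
  h.strictMonoOn.monotoneOn hs (hs.trans hst) hst

lemma nonneg (h : ClassKInf α) {t : ℝ} (ht : 0 ≤ t) : 0 ≤ α t := by
  simpa [h.map_zero] using h.mono le_rfl ht

lemma pos (h : ClassKInf α) {t : ℝ} (ht : 0 < t) : 0 < α t := by
  simpa [h.map_zero] using h.strictMonoOn (mem_Ici.2 le_rfl) (mem_Ici.2 ht.le) ht

lemma exists_le (h : ClassKInf α) {ε : ℝ} (hε : 0 < ε) : ∃ r > 0, α r ≤ ε := by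
  have hc := Metric.continuousWithinAt_iff.1 (h.continuousOn 0 (mem_Ici.2 le_rfl)) ε hε
  obtain ⟨r, hr, hr'⟩ := hc
  refine ⟨r / 2, by positivity, ?_⟩
  have := hr' (x := r / 2) (mem_Ici.2 (by positivity))
    (by rw [Real.dist_eq, sub_zero, abs_of_pos (by positivity)]; linarith)
  rw [h.map_zero, Real.dist_eq, sub_zero] at this
  exact (le_abs_self _).trans this.le

lemma tendsto_zero (h : ClassKInf α) {d : ℕ → ℝ} (hd : ∀ k, 0 ≤ d k)
    (hlim : Tendsto (fun k => α (d k)) atTop (𝓝 0)) : Tendsto d atTop (𝓝 0) := by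
  rw [Metric.tendsto_atTop]
  intro ε hε
  obtain ⟨N, hN⟩ := eventually_atTop.1 (hlim.eventually_lt_const (h.pos hε))
  refine ⟨N, fun k hk => ?_⟩
  rw [Real.dist_eq, sub_zero, abs_of_nonneg (hd k)]
  by_contra! hcon
  exact absurd (hN k hk) (not_lt.2 (h.mono hε.le hcon))

end ClassKInf

/-- Every nonnegative null sequence is dominated by a function of class `L`. -/
lemma exists_classL_ge {d : ℕ → ℝ} (hd : ∀ k, 0 ≤ d k) (hlim : Tendsto d atTop (𝓝 0)) :
    ∃ δ, ClassL δ ∧ ∀ k : ℕ, d k ≤ δ k := by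
  obtain ⟨C, hC⟩ := hlim.bddAbove_range
  have hdC : ∀ k, d k ≤ C := fun k => hC ⟨k, rfl⟩
  have hC0 : 0 ≤ C := (hd 0).trans (hdC 0)
  -- The cutoff is 1 up to time k, 0 from k + 1 on, and linear between. The supremum of the d k * w
  -- k is then antitone and C-Lipschitz.
  set w : ℕ → ℝ → ℝ := fun k t => max 0 (min 1 ((k : ℝ) + 1 - t)) with hw
  have w0 : ∀ k t, 0 ≤ w k t := fun k t => le_max_left _ _
  have w1 : ∀ k t, w k t ≤ 1 := fun k t => max_le zero_le_one (min_le_left _ _)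
  have hbdd : ∀ t, BddAbove (range fun k => d k * w k t) := fun t => by
    refine ⟨C, ?_⟩
    rintro _ ⟨k, rfl⟩
    exact (mul_le_of_le_one_right (hd k) (w1 k t)).trans (hdC k)
  have hle : ∀ k t, d k * w k t ≤ ⨆ k, d k * w k t := fun k t => le_ciSup (hbdd t) k
  have hnn : ∀ t, 0 ≤ ⨆ k, d k * w k t := fun t => (mul_nonneg (hd 0) (w0 0 t)).trans (hle 0 t)
  have hanti : Antitone fun t => ⨆ k, d k * w k t := by
    intro s t hst
    refine ciSup_mono (hbdd s) fun k => mul_le_mul_of_nonneg_left ?_ (hd k)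
    exact max_le_max le_rfl (min_le_min le_rfl (by linarith))
  have hlip : ∀ k s t, s ≤ t → w k s ≤ w k t + (t - s) := by
    intro k s t hst
    refine max_le (add_nonneg (w0 k t) (by linarith)) ?_
    have : min 1 ((k : ℝ) + 1 - s) ≤ min 1 ((k : ℝ) + 1 - t) + (t - s) := by
      rw [← min_add_add_right]
      exact min_le_min (by linarith) (by linarith)
    exact this.trans (by gcongr; exact le_max_right _ _)
  have hlip' : LipschitzWith ⟨C, hC0⟩ fun t => ⨆ k, d k * w k t := by
    have key : ∀ s t, s ≤ t → (⨆ k, d k * w k s) ≤ (⨆ k, d k * w k t) + C * (t - s) := by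
      intro s t hst
      refine ciSup_le fun k => ?_
      calc d k * w k s ≤ d k * (w k t + (t - s)) := mul_le_mul_of_nonneg_left (hlip k s t hst) (hd k)
        _ = d k * w k t + d k * (t - s) := by ring
        _ ≤ _ := add_le_add (hle k t) (mul_le_mul_of_nonneg_right (hdC k) (by linarith))
    refine LipschitzWith.of_le_add_mul _ fun s t => ?_
    rcases le_total s t with hst | hst
    · rw [Real.dist_eq, abs_sub_comm, abs_of_nonneg (by linarith)]
      exact key s t hst
    · exact (hanti hst).trans (le_add_of_nonneg_right (mul_nonneg hC0 dist_nonneg))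
  refine ⟨_, ⟨hlip'.continuous.continuousOn, fun t _ => hnn t, hanti.antitoneOn _, ?_⟩, fun k => ?_⟩
  · rw [Metric.tendsto_atTop]
    intro ε hε
    obtain ⟨N, hN⟩ := eventually_atTop.1 (hlim.eventually_lt_const (half_pos hε))
    refine ⟨(N : ℝ) + 1, fun t ht => ?_⟩
    rw [Real.dist_eq, sub_zero, abs_of_nonneg (hnn t)]
    refine lt_of_le_of_lt (ciSup_le fun k => ?_) (half_lt_self hε)
    rcases le_total N k with hk | hk
    · exact (mul_le_of_le_one_right (hd k) (w1 k t)).trans (hN k hk).le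
    · have : w k t = 0 := by
        have : (k : ℝ) ≤ N := by exact_mod_cast hk
        exact max_eq_left ((min_le_right _ _).trans (by linarith))
      rw [this, mul_zero]
      exact (half_pos hε).le
  · refine le_trans (le_of_eq ?_) (hle k k)
    simp [hw]

/-- Error bounds that hold uniformly, and with arbitrarily small error for large `N`, hold with an
error of class `L`. -/
lemma exists_classL_of_eventually {Q : ℕ → ℝ → Prop} (hQ : ∀ N a b, a ≤ b → Q N a → Q N b)
    {C : ℝ} (hC : ∀ N, Q N C) (hev : ∀ ε > 0, ∀ᶠ N in atTop, Q N ε) :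
    ∃ δ, ClassL δ ∧ ∀ N : ℕ, Q N (δ N) := by
  have hbdd : ∀ N, BddBelow {e | 0 ≤ e ∧ Q N e} := fun N => ⟨0, fun e he => he.1⟩
  have hne : ∀ N, {e | 0 ≤ e ∧ Q N e}.Nonempty := fun N =>
    ⟨max 0 C, le_max_left _ _, hQ N C _ (le_max_right _ _) (hC N)⟩
  have hinf : ∀ N, 0 ≤ sInf {e | 0 ≤ e ∧ Q N e} := fun N => le_csInf (hne N) fun e he => he.1
  have hlim : Tendsto (fun N => sInf {e | 0 ≤ e ∧ Q N e}) atTop (𝓝 0) := by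
    refine tendsto_order.2 ⟨fun a ha => Eventually.of_forall fun N => ha.trans_le (hinf N),
      fun a ha => ?_⟩
    filter_upwards [hev (a / 2) (half_pos ha)] with N hN
    exact (csInf_le (hbdd N) ⟨(half_pos ha).le, hN⟩).trans_lt (half_lt_self ha)
  -- The least admissible error need not be attained; the null sequence 1 / (N + 1) leaves room for
  -- an error that is.
  obtain ⟨δ, hδ, hle⟩ := exists_classL_ge
    (d := fun N => sInf {e | 0 ≤ e ∧ Q N e} + 1 / ((N : ℝ) + 1))
    (fun N => add_nonneg (hinf N) (by positivity))
    (by simpa using hlim.add tendsto_one_div_add_atTop_nhds_zero_nat)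
  refine ⟨δ, hδ, fun N => ?_⟩
  obtain ⟨e, he, hlt⟩ := exists_lt_of_csInf_lt (hne N)
    (lt_add_of_pos_right _ (by positivity : (0 : ℝ) < 1 / ((N : ℝ) + 1)))
  exact hQ N e _ (hlt.le.trans (hle N)) he.2

/-! ### Cesàro means along the cyclic group -/

section Cyclic

variable {p : ℕ} [NeZero p]

lemma fin_val_nsmul_one (i : Fin p) : (i : ℕ) • (1 : Fin p) = i := by
  have key : ∀ k : ℕ, ((k • (1 : Fin p) : Fin p) : ℕ) = k % p := by
    intro k
    induction k with
    | zero => simp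
    | succ k ih => rw [succ_nsmul, Fin.val_add, ih, Fin.val_one', ← Nat.add_mod]
  exact Fin.ext ((key i).trans (Nat.mod_eq_of_lt i.isLt))

lemma fin_card_nsmul_one : p • (1 : Fin p) = 0 := by
  simpa using card_nsmul_eq_zero (x := (1 : Fin p))

lemma exists_ge_add_nsmul_one_eq (i j : Fin p) (N : ℕ) : ∃ k ≥ N, i + k • (1 : Fin p) = j := by
  refine ⟨((j - i : Fin p) : ℕ) + p * N, ?_, ?_⟩
  · exact (Nat.le_mul_of_pos_left N (NeZero.pos p)).trans (Nat.le_add_left _ _)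
  · rw [add_nsmul, fin_val_nsmul_one, mul_comm, mul_nsmul', fin_card_nsmul_one]
    simp

lemma sum_range_cyclic (h : Fin p → ℝ) (i : Fin p) :
    ∑ k ∈ Finset.range p, h (i + k • (1 : Fin p)) = ∑ j, h j := by
  rw [Finset.sum_range]
  simp only [fin_val_nsmul_one]
  exact Equiv.sum_comp (Equiv.addLeft i) h

/-- After subtraction of the mean, the partial sums are p-periodic, hence bounded, and division by K
removes them. -/
lemma tendsto_cesaro_cyclic (h : Fin p → ℝ) (i : Fin p) :
    Tendsto (fun K : ℕ => (K : ℝ)⁻¹ * ∑ k ∈ Finset.range K, h (i + k • (1 : Fin p))) atTop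
      (𝓝 (1 / (p : ℝ) * ∑ j, h j)) := by
  set m : ℝ := 1 / (p : ℝ) * ∑ j, h j with hm
  have hp : (p : ℝ) ≠ 0 := Nat.cast_ne_zero.2 (NeZero.ne p)
  set s : ℕ → ℝ := fun K => ∑ k ∈ Finset.range K, (h (i + k • (1 : Fin p)) - m) with hs
  have hper : Function.Periodic s p := by
    intro K
    simp only [hs]
    rw [add_comm K p, Finset.sum_range_add]
    have h1 : ∑ k ∈ Finset.range p, (h (i + k • (1 : Fin p)) - m) = 0 := by
      rw [Finset.sum_sub_distrib, sum_range_cyclic, Finset.sum_const, Finset.card_range, hm,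
        nsmul_eq_mul]
      field_simp
      ring
    rw [h1, zero_add]
    refine Finset.sum_congr rfl fun k _ => ?_
    rw [add_nsmul, fin_card_nsmul_one, zero_add]
  obtain ⟨B, hB⟩ : ∃ B, ∀ K, |s K| ≤ B := by
    refine ⟨∑ k ∈ Finset.range p, |s k|, fun K => ?_⟩
    rw [← hper.map_mod_nat K]
    exact Finset.single_le_sum (f := fun k => |s k|) (fun _ _ => abs_nonneg _)
      (Finset.mem_range.2 (Nat.mod_lt _ (NeZero.pos p)))
  have hlim : Tendsto (fun K : ℕ => (K : ℝ)⁻¹ * s K) atTop (𝓝 0) := by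
    refine squeeze_zero_norm (a := fun K : ℕ => (K : ℝ)⁻¹ * B) (fun K => ?_) ?_
    · rw [norm_mul, Real.norm_eq_abs, Real.norm_eq_abs, abs_of_nonneg (by positivity)]
      exact mul_le_mul_of_nonneg_left (hB K) (by positivity)
    · simpa using (tendsto_inv_atTop_nhds_zero_nat (𝕜 := ℝ)).mul_const B
  have : Tendsto (fun K : ℕ => (K : ℝ)⁻¹ * s K + m) atTop (𝓝 m) := by simpa using hlim.add_const m
  refine this.congr' ?_
  filter_upwards [eventually_gt_atTop 0] with K hK
  have hK' : (K : ℝ) ≠ 0 := Nat.cast_ne_zero.2 hK.ne'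
  simp only [hs, Finset.sum_sub_distrib, Finset.sum_const, Finset.card_range, nsmul_eq_mul]
  field_simp
  ring

end Cyclic

end EMPC

namespace EMPC

namespace Problem

/-! ### Trajectories and dynamic programming -/

section Basic

variable {n m : ℕ} {S : Problem n m} {x : EuclideanSpace ℝ (Fin n)}
  {u : ℕ → EuclideanSpace ℝ (Fin m)}

lemma traj_succ' (x : EuclideanSpace ℝ (Fin n)) (u : ℕ → EuclideanSpace ℝ (Fin m)) (k : ℕ) :
    S.traj x u (k + 1) = S.traj (S.f x (u 0)) (fun j => u (j + 1)) k := by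
  induction k with
  | zero => rfl
  | succ k ih => rw [traj, ih, traj]

lemma traj_feedback (μ : EuclideanSpace ℝ (Fin n) → EuclideanSpace ℝ (Fin m))
    (x : EuclideanSpace ℝ (Fin n)) (k : ℕ) :
    S.traj x (fun k => μ (S.closedLoop μ x k)) k = S.closedLoop μ x k := by
  induction k with
  | zero => rfl
  | succ k ih => rw [traj, ih, closedLoop]

lemma sumCost_succ' (K : ℕ) (x : EuclideanSpace ℝ (Fin n))
    (u : ℕ → EuclideanSpace ℝ (Fin m)) :
    S.sumCost (K + 1) x u = S.ℓ x (u 0) + S.sumCost K (S.f x (u 0)) (fun j => u (j + 1)) := by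
  rw [sumCost, Finset.sum_range_succ', add_comm]
  simp only [traj_succ', sumCost]
  rfl

lemma sumCost_succ (K : ℕ) (x : EuclideanSpace ℝ (Fin n)) (u : ℕ → EuclideanSpace ℝ (Fin m)) :
    S.sumCost (K + 1) x u = S.sumCost K x u + S.ℓ (S.traj x u K) (u K) :=
  Finset.sum_range_succ _ _

lemma cost_succ' (N : ℕ) (x : EuclideanSpace ℝ (Fin n)) (u : ℕ → EuclideanSpace ℝ (Fin m)) :
    S.cost (N + 1) x u = S.ℓ x (u 0) + S.cost N (S.f x (u 0)) (fun j => u (j + 1)) := by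
  rw [cost, sumCost_succ', traj_succ', cost, add_assoc]

lemma mem_terminalInputs_succ {N : ℕ} : u ∈ S.terminalInputs (N + 1) x ↔
    x ∈ S.X ∧ u 0 ∈ S.U ∧ (fun j => u (j + 1)) ∈ S.terminalInputs N (S.f x (u 0)) := by
  simp only [terminalInputs, inputs, mem_ofPred_eq, traj_succ']
  constructor
  · rintro ⟨⟨hu, hx⟩, hf⟩
    refine ⟨hx 0 (Nat.zero_le _), hu 0 N.succ_pos, ⟨fun k hk => hu _ (Nat.succ_lt_succ hk),
      fun k hk => ?_⟩, hf⟩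
    rw [← traj_succ']
    exact hx _ (Nat.succ_le_succ hk)
  · rintro ⟨hx, hu0, ⟨hu, htr⟩, hf⟩
    refine ⟨⟨fun k hk => ?_, fun k hk => ?_⟩, hf⟩
    · cases k with
      | zero => exact hu0
      | succ k => exact hu k (Nat.lt_of_succ_lt_succ hk)
    · cases k with
      | zero => exact hx
      | succ k => rw [traj_succ']; exact htr k (Nat.le_of_succ_le_succ hk)

lemma mem_inputsInf_tail (hu : u ∈ S.inputsInf x) :
    (fun j => u (j + 1)) ∈ S.inputsInf (S.f x (u 0)) :=
  ⟨fun k => hu.1 (k + 1), fun k => by rw [← traj_succ']; exact hu.2 (k + 1)⟩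

variable (hb : ∀ N x, BddBelow (S.cost N x '' S.terminalInputs N x))
include hb

/-- A real `sInf` is 0 on a set unbounded below, so boundedness is assumed here; `bddBelow_cost`
later derives it from dissipativity. -/
lemma value_le_cost {N : ℕ} (hu : u ∈ S.terminalInputs N x) : S.value N x ≤ S.cost N x u :=
  csInf_le (hb N x) (mem_image_of_mem _ hu)

lemma feasible_cons {N : ℕ} {a : EuclideanSpace ℝ (Fin m)} (hx : x ∈ S.X) (ha : a ∈ S.U)
    (hf : S.f x a ∈ S.feasible N) :
    x ∈ S.feasible (N + 1) ∧ S.value (N + 1) x ≤ S.ℓ x a + S.value N (S.f x a) := by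
  have key : ∀ v ∈ S.terminalInputs N (S.f x a),
      (fun j => Nat.casesOn (motive := fun _ => EuclideanSpace ℝ (Fin m)) j a v) ∈
        S.terminalInputs (N + 1) x := fun v hv =>
    mem_terminalInputs_succ.2 ⟨hx, ha, hv⟩
  refine ⟨⟨hx, ?_⟩, ?_⟩
  · obtain ⟨v, hv⟩ := hf.2
    exact ⟨_, key v hv⟩
  · rw [← sub_le_iff_le_add']
    refine le_csInf (hf.2.image _) ?_
    rintro _ ⟨v, hv, rfl⟩
    rw [sub_le_iff_le_add']
    exact (value_le_cost hb (key v hv)).trans_eq (cost_succ' N x _)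

/-- Dynamic programming: apply the first k inputs of u, then any admissible sequence for the
remaining horizon. -/
lemma feasible_of_traj {N : ℕ} (k : ℕ) (hu : u ∈ S.inputsInf x)
    (hf : S.traj x u k ∈ S.feasible N) :
    x ∈ S.feasible (N + k) ∧ S.value (N + k) x ≤ S.sumCost k x u + S.value N (S.traj x u k) := by
  induction k generalizing x u with
  | zero => exact ⟨hf, by simp [sumCost, traj]⟩
  | succ k ih =>
    rw [traj_succ'] at hf
    obtain ⟨h1, h2⟩ := ih (mem_inputsInf_tail hu) hf
    obtain ⟨h3, h4⟩ := feasible_cons (x := x) hb (hu.2 0) (hu.1 0) h1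
    refine ⟨h3, ?_⟩
    rw [sumCost_succ', traj_succ', ← add_assoc N k 1]
    linarith

end Basic

section Orbit

variable {n m p : ℕ} [NeZero p] {S : Problem n m} {P : S.PeriodicOrbit p}

lemma mem_feasible_zero {x : EuclideanSpace ℝ (Fin n)} (hX : x ∈ S.X) (hx : x ∈ S.Xf) :
    x ∈ S.feasible 0 :=
  ⟨hX, 0, ⟨fun k hk => absurd hk (Nat.not_lt_zero k),
    fun k hk => by rw [Nat.le_zero.1 hk]; exact hX⟩, hx⟩

lemma value_zero {x : EuclideanSpace ℝ (Fin n)} (hX : x ∈ S.X) (hx : x ∈ S.Xf) :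
    S.value 0 x = S.Vf x := by
  have : S.cost 0 x = fun _ => S.Vf x := by
    funext u
    simp [cost, sumCost, traj]
  rw [value, this, (mem_feasible_zero hX hx).2.image_const, csInf_singleton]

section

variable (hb : ∀ N x, BddBelow (S.cost N x '' S.terminalInputs N x))
  (hterm : TerminalConditions P) (hzero : P.avgCost = 0)
include hb hterm hzero

/-- Appending one step of the terminal controller does not raise the cost, as the orbit has average
cost zero. An arbitrary admissible u is allowed, so that the tail of an optimizer qualifies. -/
lemma value_succ_le_cost {N : ℕ} {x : EuclideanSpace ℝ (Fin n)}
    {u : ℕ → EuclideanSpace ℝ (Fin m)} (hu : u ∈ S.terminalInputs N x) :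
    x ∈ S.feasible (N + 1) ∧ S.value (N + 1) x ≤ S.cost N x u := by
  induction N generalizing x u with
  | zero =>
    have hx : x ∈ S.Xf := hu.2
    obtain ⟨a, ha, hfX, hfXf, hle⟩ := hterm.exists_control x hx
    obtain ⟨h1, h2⟩ := feasible_cons hb (hterm.subset hx) ha (mem_feasible_zero hfX hfXf)
    refine ⟨h1, ?_⟩
    rw [value_zero hfX hfXf] at h2
    simp only [cost, sumCost, Finset.range_zero, Finset.sum_empty, traj]
    linarith
  | succ N ih =>
    obtain ⟨hx, hu0, ht⟩ := mem_terminalInputs_succ.1 hu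
    obtain ⟨h1, h2⟩ := ih ht
    obtain ⟨h3, h4⟩ := feasible_cons hb hx hu0 h1
    exact ⟨h3, by rw [cost_succ']; linarith⟩

lemma value_succ_le {N : ℕ} {x : EuclideanSpace ℝ (Fin n)} (hx : x ∈ S.feasible N) :
    x ∈ S.feasible (N + 1) ∧ S.value (N + 1) x ≤ S.value N x := by
  obtain ⟨u, hu⟩ := hx.2
  refine ⟨(value_succ_le_cost hb hterm hzero hu).1, le_csInf (hx.2.image _) ?_⟩
  rintro _ ⟨v, hv, rfl⟩
  exact (value_succ_le_cost hb hterm hzero hv).2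

lemma value_mono {N M : ℕ} (hNM : N ≤ M) {x : EuclideanSpace ℝ (Fin n)} (hx : x ∈ S.feasible N) :
    x ∈ S.feasible M ∧ S.value M x ≤ S.value N x := by
  induction M, hNM using Nat.le_induction with
  | base => exact ⟨hx, le_rfl⟩
  | succ M _ ih =>
    obtain ⟨h1, h2⟩ := value_succ_le hb hterm hzero ih.1
    exact ⟨h1, h2.trans ih.2⟩

lemma value_le_terminal (N : ℕ) {x : EuclideanSpace ℝ (Fin n)} (hx : x ∈ S.Xf) :
    x ∈ S.feasible N ∧ S.value N x ≤ S.Vf x := by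
  have hX := hterm.subset hx
  rw [← value_zero hX hx]
  exact value_mono hb hterm hzero N.zero_le (mem_feasible_zero hX hx)

/-- The tail of an optimizer is admissible from the successor state with horizon one shorter; the
terminal controller restores the horizon at no extra cost. -/
lemma closedLoop_descent {N : ℕ} (hN : 1 ≤ N)
    {μ : EuclideanSpace ℝ (Fin n) → EuclideanSpace ℝ (Fin m)} (hμ : S.IsOptimalFeedback N μ)
    {x : EuclideanSpace ℝ (Fin n)} (hx : x ∈ S.feasible N) :
    μ x ∈ S.U ∧ S.f x (μ x) ∈ S.feasible N ∧
      S.ℓ x (μ x) + S.value N (S.f x (μ x)) ≤ S.value N x := by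
  obtain ⟨M, rfl⟩ := Nat.exists_eq_add_of_le' hN
  obtain ⟨u, hu, hopt, h0⟩ := hμ x hx
  obtain ⟨-, hu0, ht⟩ := mem_terminalInputs_succ.1 hu
  obtain ⟨h1, h2⟩ := value_succ_le_cost hb hterm hzero ht
  rw [h0, ← hopt, cost_succ']
  exact ⟨hu0, h1, by linarith⟩

lemma closedLoop_sumCost_le {N : ℕ} (hN : 1 ≤ N)
    {μ : EuclideanSpace ℝ (Fin n) → EuclideanSpace ℝ (Fin m)} (hμ : S.IsOptimalFeedback N μ)
    {x : EuclideanSpace ℝ (Fin n)} (hx : x ∈ S.feasible N) :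
    (fun k => μ (S.closedLoop μ x k)) ∈ S.inputsInf x ∧
      ∀ K, S.sumCost K x (fun k => μ (S.closedLoop μ x k)) +
        S.value N (S.closedLoop μ x K) ≤ S.value N x := by
  have hfeas : ∀ k, S.closedLoop μ x k ∈ S.feasible N := by
    intro k
    induction k with
    | zero => exact hx
    | succ k ih => exact (closedLoop_descent hb hterm hzero hN hμ ih).2.1
  refine ⟨⟨fun k => (closedLoop_descent hb hterm hzero hN hμ (hfeas k)).1, fun k => ?_⟩,
    fun K => ?_⟩
  · rw [traj_feedback]
    exact (hfeas k).1
  · induction K with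
    | zero => simp [sumCost, closedLoop]
    | succ K ih =>
      have := (closedLoop_descent hb hterm hzero hN hμ (hfeas K)).2.2
      rw [sumCost_succ, traj_feedback, closedLoop]
      linarith

end

/-! ### Distance to the orbit and phase locking -/

lemma PeriodicOrbit.dist_nonneg (x : EuclideanSpace ℝ (Fin n)) (u : EuclideanSpace ℝ (Fin m)) :
    0 ≤ P.dist x u :=
  le_ciInf fun _ => norm_nonneg _

lemma PeriodicOrbit.exists_dist_eq (P : S.PeriodicOrbit p) (x : EuclideanSpace ℝ (Fin n))
    (u : EuclideanSpace ℝ (Fin m)) :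
    ∃ i, ‖x - P.x i‖ ≤ P.dist x u ∧ ‖u - P.u i‖ ≤ P.dist x u := by
  obtain ⟨i, hi⟩ := exists_eq_ciInf_of_finite
    (f := fun i => ‖WithLp.toLp 2 (x - P.x i, u - P.u i)‖)
  refine ⟨i, ?_⟩
  rw [PeriodicOrbit.dist, ← hi]
  exact ⟨WithLp.norm_fst_le (p := 2) (x := WithLp.toLp 2 (x - P.x i, u - P.u i)),
    WithLp.norm_snd_le (p := 2) (x := WithLp.toLp 2 (x - P.x i, u - P.u i))⟩

lemma PeriodicOrbit.distX_le (P : S.PeriodicOrbit p) (x : EuclideanSpace ℝ (Fin n)) (i : Fin p) :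
    P.distX x ≤ ‖x - P.x i‖ :=
  ciInf_le ⟨0, by rintro _ ⟨i, rfl⟩; exact norm_nonneg _⟩ i

lemma PeriodicOrbit.distX_nonneg (P : S.PeriodicOrbit p) (x : EuclideanSpace ℝ (Fin n)) :
    0 ≤ P.distX x :=
  le_ciInf fun _ => norm_nonneg _

lemma PeriodicOrbit.distX_le_dist (P : S.PeriodicOrbit p) (x : EuclideanSpace ℝ (Fin n))
    (u : EuclideanSpace ℝ (Fin m)) : P.distX x ≤ P.dist x u := by
  obtain ⟨i, hi, -⟩ := P.exists_dist_eq x u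
  exact (P.distX_le x i).trans hi

lemma ContComp.isCompact_X (hcont : S.ContComp) (P : S.PeriodicOrbit p) : IsCompact S.X := by
  have := hcont.isCompact.image continuous_fst
  rwa [fst_image_prod _ ⟨P.u 0, P.u_mem 0⟩] at this

/-- A trajectory whose state-input pairs approach a minimal orbit asymptotically follows the orbit
with a fixed phase shift. -/
lemma exists_phase (hcont : S.ContComp) (hmin : P.IsMinimal) {x : EuclideanSpace ℝ (Fin n)}
    {u : ℕ → EuclideanSpace ℝ (Fin m)} (hu : u ∈ S.inputsInf x)
    (hlim : Tendsto (fun k => P.dist (S.traj x u k) (u k)) atTop (𝓝 0)) :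
    ∃ i, Tendsto (fun k => ‖S.traj x u k - P.x (i + k • (1 : Fin p))‖) atTop (𝓝 0) := by
  choose i hix hiu using fun k => P.exists_dist_eq (S.traj x u k) (u k)
  have hx : Tendsto (fun k => ‖S.traj x u k - P.x (i k)‖) atTop (𝓝 0) :=
    squeeze_zero (fun _ => norm_nonneg _) hix hlim
  have hpair : Tendsto (fun k => dist (S.traj x u k, u k) (P.x (i k), P.u (i k))) atTop (𝓝 0) := by
    refine squeeze_zero (fun _ => _root_.dist_nonneg) (fun k => ?_) hlim
    rw [Prod.dist_eq, dist_eq_norm, dist_eq_norm]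
    exact max_le (hix k) (hiu k)
  -- Uniform continuity of f carries closeness of the state-input pair to closeness of the successor
  -- to the next orbit state.
  have hstep : Tendsto (fun k => ‖S.traj x u (k + 1) - P.x (i k + 1)‖) atTop (𝓝 0) := by
    have huc := hcont.isCompact.uniformContinuousOn_of_continuous hcont.continuousOn_f
    rw [Metric.uniformContinuousOn_iff] at huc
    rw [Metric.tendsto_atTop]
    intro ε hε
    obtain ⟨r, hr, hr'⟩ := huc ε hε
    obtain ⟨K, hK⟩ := eventually_atTop.1 (hpair.eventually_lt_const hr)
    refine ⟨K, fun k hk => ?_⟩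
    rw [Real.dist_eq, sub_zero, abs_norm, ← dist_eq_norm, traj, P.step]
    exact hr' (S.traj x u k, u k) (mk_mem_prod (hu.2 k) (hu.1 k)) (P.x (i k), P.u (i k))
      (mk_mem_prod (P.x_mem _) (P.u_mem _)) (hK k hk)
  have hev : ∀ᶠ k in atTop, i (k + 1) = i k + 1 := by
    have hsum : Tendsto (fun k => ‖S.traj x u (k + 1) - P.x (i (k + 1))‖ +
        ‖S.traj x u (k + 1) - P.x (i k + 1)‖) atTop (𝓝 0) := by
      simpa using (hx.comp (tendsto_add_atTop_nat 1)).add hstep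
    -- Distinct orbit states have a positive minimal gap; with a single state there is no pair to
    -- minimize over and any r serves. Once x_{k+1} is close to both candidates, their indices must
    -- agree.
    obtain ⟨r, hr, hsep⟩ : ∃ r > 0, ∀ a b, P.x a ≠ P.x b → r ≤ ‖P.x a - P.x b‖ := by
      rcases isEmpty_or_nonempty {q : Fin p × Fin p // P.x q.1 ≠ P.x q.2} with he | he
      · exact ⟨1, one_pos, fun a b hab => (he.false ⟨(a, b), hab⟩).elim⟩
      · obtain ⟨q, hq⟩ := Finite.exists_min
          (fun q : {q : Fin p × Fin p // P.x q.1 ≠ P.x q.2} => ‖P.x q.1.1 - P.x q.1.2‖)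
        exact ⟨_, norm_pos_iff.2 (sub_ne_zero.2 q.2), fun a b hab => hq ⟨(a, b), hab⟩⟩
    filter_upwards [hsum.eventually_lt_const hr] with k hk
    by_contra hne
    have h1 := hsep _ _ (hmin.ne hne)
    have h2 := norm_sub_le (S.traj x u (k + 1) - P.x (i k + 1))
      (S.traj x u (k + 1) - P.x (i (k + 1)))
    rw [sub_sub_sub_cancel_left] at h2
    linarith
  obtain ⟨K, hK⟩ := eventually_atTop.1 hev
  -- The phase is extrapolated back to time 0 from time K, after which the nearest index advances by
  -- one per step.
  refine ⟨i K - K • (1 : Fin p), hx.congr' ?_⟩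
  filter_upwards [eventually_ge_atTop K] with k hk
  have : i k = i K - K • (1 : Fin p) + k • (1 : Fin p) := by
    induction k, hk using Nat.le_induction with
    | base => simp
    | succ k hk ih => rw [hK k hk, ih, succ_nsmul, add_assoc]
  rw [this]

lemma tendsto_sub_of_phase {A : Set (EuclideanSpace ℝ (Fin n))} (hA : IsCompact A)
    {g : EuclideanSpace ℝ (Fin n) → ℝ} (hg : ContinuousOn g A)
    {y z : ℕ → EuclideanSpace ℝ (Fin n)} (hy : ∀ k, y k ∈ A) (hz : ∀ k, z k ∈ A)
    (hlim : Tendsto (fun k => ‖y k - z k‖) atTop (𝓝 0)) :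
    Tendsto (fun k => g (y k) - g (z k)) atTop (𝓝 0) := by
  have huc := hA.uniformContinuousOn_of_continuous hg
  rw [Metric.uniformContinuousOn_iff] at huc
  rw [Metric.tendsto_atTop]
  intro ε hε
  obtain ⟨r, hr, hr'⟩ := huc ε hε
  obtain ⟨K, hK⟩ := eventually_atTop.1 (hlim.eventually_lt_const hr)
  refine ⟨K, fun k hk => ?_⟩
  rw [Real.dist_eq, sub_zero, ← Real.dist_eq]
  exact hr' _ (hy k) _ (hz k) (by rw [dist_eq_norm]; exact hK k hk)

end Orbit
end Problem
end EMPC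

namespace EMPC
namespace Problem

/-! ### Rotated costs and the rotated terminal cost -/

section Dissipative

variable {n m p : ℕ} [NeZero p] {S : Problem n m} {P : S.PeriodicOrbit p}

/-- The sum of the first `K` rotated stage costs `ℓ(x, u) + λ(x) - λ(f(x, u))`. -/
def rotSum (S : Problem n m) (lam : EuclideanSpace ℝ (Fin n) → ℝ) (K : ℕ)
    (x : EuclideanSpace ℝ (Fin n)) (u : ℕ → EuclideanSpace ℝ (Fin m)) : ℝ :=
  S.sumCost K x u + lam x - lam (S.traj x u K)

variable {lam : EuclideanSpace ℝ (Fin n) → ℝ} {α : ℝ → ℝ} {x : EuclideanSpace ℝ (Fin n)}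
  {u : ℕ → EuclideanSpace ℝ (Fin m)}

lemma rotSum_zero : S.rotSum lam 0 x u = 0 := by
  simp [rotSum, sumCost, traj]

/-- Expresses V_Π through the orbit mean of λ that also appears in the Cesàro costs, so that the two
cancel. -/
lemma avgTerminal_eq {c : ℝ} (hc : ∀ j, S.Vf (P.x j) + lam (P.x j) = c) :
    P.avgTerminal = c - 1 / (p : ℝ) * ∑ i, lam (P.x i) := by
  have hp : (p : ℝ) ≠ 0 := Nat.cast_ne_zero.2 (NeZero.ne p)
  have : ∑ i, S.Vf (P.x i) = p * c - ∑ i, lam (P.x i) := by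
    rw [eq_sub_iff_add_eq, ← Finset.sum_add_distrib, Finset.sum_congr rfl fun j _ => hc j]
    simp
  rw [PeriodicOrbit.avgTerminal, this]
  field_simp

variable (hα : ClassKInf α)
  (hdiss : ∀ x ∈ S.X, ∀ u ∈ S.U, S.f x u ∈ S.X → α (P.dist x u) ≤ S.ℓ x u + lam x - lam (S.f x u))
include hdiss

lemma rotSum_succ_ge {K : ℕ} (hx : S.traj x u K ∈ S.X) (hu : u K ∈ S.U)
    (hx' : S.traj x u (K + 1) ∈ S.X) :
    S.rotSum lam K x u + α (P.dist (S.traj x u K) (u K)) ≤ S.rotSum lam (K + 1) x u := by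
  have := hdiss _ hx _ hu hx'
  rw [rotSum, rotSum, sumCost_succ, traj]
  linarith

lemma sum_dist_le_rotSum (hu : u ∈ S.inputsInf x) (K : ℕ) :
    ∑ k ∈ Finset.range K, α (P.dist (S.traj x u k) (u k)) ≤ S.rotSum lam K x u := by
  induction K with
  | zero => simp [rotSum_zero]
  | succ K ih =>
    rw [Finset.sum_range_succ]
    have := rotSum_succ_ge hdiss (hu.2 K) (hu.1 K) (hu.2 (K + 1))
    linarith

include hα

lemma rotSum_nonneg {N : ℕ} (hu : u ∈ S.inputs N x) : 0 ≤ S.rotSum lam N x u := by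
  have : ∀ K ≤ N, 0 ≤ S.rotSum lam K x u := by
    intro K hK
    induction K with
    | zero => exact rotSum_zero.ge
    | succ K ih =>
      have h1 := rotSum_succ_ge hdiss (hu.2 K (by omega)) (hu.1 K hK) (hu.2 (K + 1) hK)
      have h2 := hα.nonneg (PeriodicOrbit.dist_nonneg (P := P) (S.traj x u K) (u K))
      linarith [ih (by omega)]
  exact this N le_rfl

lemma rotSum_monotone (hu : u ∈ S.inputsInf x) : Monotone fun K => S.rotSum lam K x u := by
  refine monotone_nat_of_le_succ fun K => ?_
  have h1 := rotSum_succ_ge hdiss (hu.2 K) (hu.1 K) (hu.2 (K + 1))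
  have h2 := hα.nonneg (PeriodicOrbit.dist_nonneg (P := P) (S.traj x u K) (u K))
  linarith

/-- The distances, measured by α, have partial sums at most R, so they are summable and tend to
zero. -/
lemma tendsto_dist_of_rotSum_le (hu : u ∈ S.inputsInf x) {R : ℝ}
    (hR : ∀ K, S.rotSum lam K x u ≤ R) :
    Tendsto (fun k => P.dist (S.traj x u k) (u k)) atTop (𝓝 0) := by
  refine hα.tendsto_zero (fun k => PeriodicOrbit.dist_nonneg _ _) ?_
  exact (summable_of_sum_range_le (fun k => hα.nonneg (PeriodicOrbit.dist_nonneg _ _))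
    fun K => (sum_dist_le_rotSum hdiss hu K).trans (hR K)).tendsto_atTop_zero

lemma exists_phase_of_rotSum_le (hcont : S.ContComp) (hmin : P.IsMinimal)
    (hu : u ∈ S.inputsInf x) {R : ℝ} (hR : ∀ K, S.rotSum lam K x u ≤ R) :
    ∃ i, Tendsto (fun k => ‖S.traj x u k - P.x (i + k • (1 : Fin p))‖) atTop (𝓝 0) :=
  exists_phase hcont hmin hu (tendsto_dist_of_rotSum_le hα hdiss hu hR)

/-- The phase is irrelevant to the mean over a cycle. The index k + 1 matches the partial sums
entering the Cesàro cost. -/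
lemma tendsto_mean_of_rotSum_le (hcont : S.ContComp) (hmin : P.IsMinimal)
    (hlam : ContinuousOn lam S.X) (hu : u ∈ S.inputsInf x) {R : ℝ}
    (hR : ∀ K, S.rotSum lam K x u ≤ R) :
    Tendsto (fun K : ℕ => (K : ℝ)⁻¹ * ∑ k ∈ Finset.range K, lam (S.traj x u (k + 1))) atTop
      (𝓝 (1 / (p : ℝ) * ∑ i, lam (P.x i))) := by
  obtain ⟨i, hi⟩ := exists_phase_of_rotSum_le hα hdiss hcont hmin hu hR
  have h1 := (tendsto_sub_of_phase (hcont.isCompact_X P) hlam hu.2 (fun k => P.x_mem _) hi).comp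
    (tendsto_add_atTop_nat 1)
  have h2 := h1.cesaro.add (tendsto_cesaro_cyclic (fun j => lam (P.x j)) (i + 1))
  rw [zero_add] at h2
  refine h2.congr fun K => ?_
  rw [← mul_add, ← Finset.sum_add_distrib]
  refine congrArg _ (Finset.sum_congr rfl fun k _ => ?_)
  simp only [Function.comp_apply]
  rw [succ_nsmul', ← add_assoc i 1, sub_add_cancel]

variable (hcont : S.ContComp) (hterm : TerminalConditions P) (hmin : P.IsMinimal)
  (hlam : ContinuousOn lam S.X) (hzero : P.avgCost = 0)
include hcont hterm hmin hlam hzero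

/-- The rotated terminal cost is bounded below by its values on the orbit. -/
lemma rotTerminal_orbit_le (hx : x ∈ S.Xf) (j : Fin p) :
    S.Vf (P.x j) + lam (P.x j) ≤ S.Vf x + lam x := by
  choose! κ hκU hκX hκf hκ using hterm.exists_control
  have hmem : ∀ k, S.closedLoop κ x k ∈ S.Xf := by
    intro k
    induction k with
    | zero => exact hx
    | succ k ih => exact hκf _ ih
  set u : ℕ → EuclideanSpace ℝ (Fin m) := fun k => κ (S.closedLoop κ x k) with hu_def
  have htr : ∀ k, S.traj x u k = S.closedLoop κ x k := traj_feedback κ x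
  have hXf : ∀ k, S.traj x u k ∈ S.Xf := fun k => by rw [htr]; exact hmem k
  have hu : u ∈ S.inputsInf x := ⟨fun k => hκU _ (hmem k), fun k => hterm.subset (hXf k)⟩
  have hsum : ∀ K, S.sumCost K x u + S.Vf (S.traj x u K) ≤ S.Vf x := by
    intro K
    induction K with
    | zero => simp [sumCost, traj]
    | succ K ih =>
      have := hκ _ (hmem K)
      rw [hzero] at this
      rw [sumCost_succ]
      rw [htr] at ih ⊢
      rw [htr]
      simp only [closedLoop, hu_def] at ih ⊢
      linarith
  set W : EuclideanSpace ℝ (Fin n) → ℝ := fun y => S.Vf y + lam y with hW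
  have hWc : ContinuousOn W S.Xf := hcont.continuousOn_Vf.add (hlam.mono hterm.subset)
  have hrot : ∀ K, S.rotSum lam K x u ≤ W x - W (S.traj x u K) := fun K => by
    have := hsum K
    simp only [rotSum, hW]
    linarith
  obtain ⟨B, hB⟩ := (hterm.isCompact.image_of_continuousOn hWc).bddBelow
  obtain ⟨i, hi⟩ := exists_phase_of_rotSum_le (R := W x - B) hα hdiss hcont hmin hu fun K =>
    (hrot K).trans (sub_le_sub_left (hB (mem_image_of_mem _ (hXf K))) _)
  have hlim := tendsto_sub_of_phase hterm.isCompact hWc hXf (fun k => hterm.orbit_mem _) hi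
  -- The trajectory shadows the state with index j at arbitrarily late times. At such a time W would
  -- exceed its initial value, making the rotated sum negative.
  by_contra! hlt
  obtain ⟨K, hK⟩ := eventually_atTop.1
    (hlim.eventually_const_lt (show W x - W (P.x j) < 0 from sub_neg.2 hlt))
  obtain ⟨k, hk, hkj⟩ := exists_ge_add_nsmul_one_eq i j K
  have h1 := hK k hk
  rw [hkj] at h1
  have h2 := hrot k
  have h3 := rotSum_nonneg hα hdiss (N := k) (x := x) (u := u) ⟨fun l _ => hu.1 l, fun l _ => hu.2 l⟩
  linarith

lemma rotTerminal_orbit_eq (i j : Fin p) :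
    S.Vf (P.x i) + lam (P.x i) = S.Vf (P.x j) + lam (P.x j) :=
  le_antisymm
    (rotTerminal_orbit_le hα hdiss hcont hterm hmin hlam hzero (hterm.orbit_mem j) i)
    (rotTerminal_orbit_le hα hdiss hcont hterm hmin hlam hzero (hterm.orbit_mem i) j)

lemma le_cost_add {N : ℕ} (hu : u ∈ S.terminalInputs N x) (j : Fin p) :
    S.Vf (P.x j) + lam (P.x j) ≤ S.cost N x u + lam x := by
  have h1 := rotTerminal_orbit_le hα hdiss hcont hterm hmin hlam hzero hu.2 j
  have h2 := rotSum_nonneg hα hdiss hu.1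
  rw [rotSum] at h2
  rw [cost]
  linarith

lemma bddBelow_cost (N : ℕ) (x : EuclideanSpace ℝ (Fin n)) :
    BddBelow (S.cost N x '' S.terminalInputs N x) := by
  refine ⟨S.Vf (P.x 0) + lam (P.x 0) - lam x, ?_⟩
  rintro _ ⟨u, hu, rfl⟩
  linarith [le_cost_add hα hdiss hcont hterm hmin hlam hzero hu 0]

lemma le_value_add {N : ℕ} (hx : x ∈ S.feasible N) (j : Fin p) :
    S.Vf (P.x j) + lam (P.x j) ≤ S.value N x + lam x := by
  rw [← sub_le_iff_le_add]
  refine le_csInf (hx.2.image _) ?_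
  rintro _ ⟨u, hu, rfl⟩
  linarith [le_cost_add hα hdiss hcont hterm hmin hlam hzero hu j]

end Dissipative

end Problem
end EMPC

namespace EMPC
namespace Problem

/-! ### Cesàro costs and the turnpike estimate -/

section Performance

variable {n m p : ℕ} [NeZero p] {S : Problem n m} {P : S.PeriodicOrbit p}
  {lam : EuclideanSpace ℝ (Fin n) → ℝ} {α : ℝ → ℝ} {x : EuclideanSpace ℝ (Fin n)}
  {u : ℕ → EuclideanSpace ℝ (Fin m)}

lemma cesaroCost_mono_of_le {K : ℕ} {b : ℕ → ℝ} (h : ∀ k, S.sumCost (k + 1) x u ≤ b k) :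
    S.cesaroCost K x u ≤ (K : ℝ)⁻¹ * ∑ k ∈ Finset.range K, b k := by
  rw [cesaroCost, one_div]
  exact mul_le_mul_of_nonneg_left (Finset.sum_le_sum fun k _ => h k) (by positivity)

lemma le_cesaroCost_of_le {K : ℕ} {b : ℕ → ℝ} (h : ∀ k, b k ≤ S.sumCost (k + 1) x u) :
    (K : ℝ)⁻¹ * ∑ k ∈ Finset.range K, b k ≤ S.cesaroCost K x u := by
  rw [cesaroCost, one_div]
  exact mul_le_mul_of_nonneg_left (Finset.sum_le_sum fun k _ => h k) (by positivity)

lemma cesaroCostInf_le {b : ℕ → ℝ} {l : ℝ} (h : ∀ k, S.sumCost (k + 1) x u ≤ b k)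
    (hb : Tendsto (fun K : ℕ => (K : ℝ)⁻¹ * ∑ k ∈ Finset.range K, b k) atTop (𝓝 l)) :
    S.cesaroCostInf x u ≤ l := by
  rw [← ((continuous_coe_real_ereal.tendsto l).comp hb).limsup_eq]
  exact limsup_le_limsup (Eventually.of_forall fun K =>
    EReal.coe_le_coe_iff.2 (cesaroCost_mono_of_le h))

lemma le_cesaroCostInf {b : ℕ → ℝ} {l : ℝ} (h : ∀ k, b k ≤ S.sumCost (k + 1) x u)
    (hb : Tendsto (fun K : ℕ => (K : ℝ)⁻¹ * ∑ k ∈ Finset.range K, b k) atTop (𝓝 l)) :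
    (l : EReal) ≤ S.cesaroCostInf x u := by
  rw [← ((continuous_coe_real_ereal.tendsto l).comp hb).limsup_eq]
  exact limsup_le_limsup (Eventually.of_forall fun K =>
    EReal.coe_le_coe_iff.2 (le_cesaroCost_of_le h))

lemma tendsto_mean_add {b g : ℕ → ℝ} {r l : ℝ} (hb : Tendsto b atTop (𝓝 r))
    (hg : Tendsto (fun K : ℕ => (K : ℝ)⁻¹ * ∑ k ∈ Finset.range K, g k) atTop (𝓝 l)) :
    Tendsto (fun K : ℕ => (K : ℝ)⁻¹ * ∑ k ∈ Finset.range K, (b k + g k)) atTop (𝓝 (r + l)) := by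
  refine (hb.cesaro.add hg).congr fun K => ?_
  rw [← mul_add, ← Finset.sum_add_distrib]

variable (hα : ClassKInf α)
  (hdiss : ∀ x ∈ S.X, ∀ u ∈ S.U, S.f x u ∈ S.X → α (P.dist x u) ≤ S.ℓ x u + lam x - lam (S.f x u))
  (hcont : S.ContComp) (hmin : P.IsMinimal) (hlam : ContinuousOn lam S.X)
include hα hdiss hcont hmin hlam

/-- A partial cost is the rotated sum minus λ(x) plus λ at the final state; averaging turns the last
term into the orbit mean. -/
lemma cesaroCostInf_le_of_rotSum_le (hu : u ∈ S.inputsInf x) {R : ℝ}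
    (hR : ∀ K, S.rotSum lam K x u ≤ R) :
    S.cesaroCostInf x u ≤ ((R - lam x + 1 / (p : ℝ) * ∑ i, lam (P.x i) : ℝ) : EReal) := by
  refine cesaroCostInf_le (b := fun k => (R - lam x) + lam (S.traj x u (k + 1))) (fun k => ?_)
    (tendsto_mean_add tendsto_const_nhds
      (tendsto_mean_of_rotSum_le hα hdiss hcont hmin hlam hu hR))
  have := hR (k + 1)
  rw [rotSum] at this
  linarith

/-- If the rotated cost of `u` exceeds `a` whenever it is bounded, then so does the Cesàro cost, up
to the storage terms. -/
lemma le_cesaroCostInf_of_rotSum (hu : u ∈ S.inputsInf x) {a : ℝ}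
    (ha : ∀ R, (∀ K, S.rotSum lam K x u ≤ R) → a ≤ R) :
    ((a - lam x + 1 / (p : ℝ) * ∑ i, lam (P.x i) : ℝ) : EReal) ≤ S.cesaroCostInf x u := by
  have hmono := rotSum_monotone hα hdiss hu
  by_cases hbdd : BddAbove (range fun K => S.rotSum lam K x u)
  · have hR : ∀ K, S.rotSum lam K x u ≤ ⨆ K, S.rotSum lam K x u := le_ciSup hbdd
    have hlim := (tendsto_atTop_ciSup hmono hbdd).comp (tendsto_add_atTop_nat 1)
    refine le_trans (EReal.coe_le_coe_iff.2 ?_) (le_cesaroCostInf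
      (b := fun k => (S.rotSum lam (k + 1) x u - lam x) + lam (S.traj x u (k + 1))) (fun k => ?_)
      (tendsto_mean_add (hlim.sub_const _)
        (tendsto_mean_of_rotSum_le hα hdiss hcont hmin hlam hu hR)))
    · have := ha _ hR
      linarith
    · rw [rotSum]
      linarith
  · obtain ⟨B, hB⟩ := ((hcont.isCompact_X P).image_of_continuousOn hlam).bddBelow
    have hB' : ∀ k, B ≤ lam (S.traj x u k) := fun k => hB (mem_image_of_mem _ (hu.2 k))
    have htop : Tendsto (fun K => S.rotSum lam K x u) atTop atTop :=
      (tendsto_atTop_of_monotone hmono).resolve_right fun ⟨l, hl⟩ => hbdd hl.bddAbove_range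
    -- Unbounded rotated sums are truncated at M, which is chosen so that M + B, with B a lower
    -- bound of λ, is a plus the orbit mean of λ.
    set M : ℝ := a + 1 / (p : ℝ) * ∑ i, lam (P.x i) - B with hM
    have hlim : Tendsto (fun k => min (S.rotSum lam (k + 1) x u) M - lam x + B) atTop
        (𝓝 (M - lam x + B)) := by
      refine tendsto_const_nhds.congr' ?_
      filter_upwards [(htop.comp (tendsto_add_atTop_nat 1)).eventually_ge_atTop M] with k hk
      rw [min_eq_right (show M ≤ S.rotSum lam (k + 1) x u from hk)]
    refine le_trans (EReal.coe_le_coe_iff.2 ?_) (le_cesaroCostInf (fun k => ?_) hlim.cesaro)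
    · linarith
    · have h1 := min_le_left (S.rotSum lam (k + 1) x u) M
      have h2 := hB' (k + 1)
      have h3 : S.rotSum lam (k + 1) x u =
        S.sumCost (k + 1) x u + lam x - lam (S.traj x u (k + 1)) := rfl
      linarith

variable (hterm : TerminalConditions P) (hzero : P.avgCost = 0)
include hterm hzero

lemma closedLoopCostInf_le {N : ℕ} (hN : 1 ≤ N) (hx : x ∈ S.feasible N)
    {μ : EuclideanSpace ℝ (Fin n) → EuclideanSpace ℝ (Fin m)} (hμ : S.IsOptimalFeedback N μ) :
    S.closedLoopCostInf x μ ≤ ((S.value N x - P.avgTerminal : ℝ) : EReal) := by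
  have hb := bddBelow_cost hα hdiss hcont hterm hmin hlam hzero
  obtain ⟨hu, hle⟩ := closedLoop_sumCost_le hb hterm hzero hN hμ hx
  have hc := rotTerminal_orbit_eq hα hdiss hcont hterm hmin hlam hzero
  have hfeas : ∀ K, S.closedLoop μ x K ∈ S.feasible N := by
    intro K
    induction K with
    | zero => exact hx
    | succ K ih => exact (closedLoop_descent hb hterm hzero hN hμ ih).2.1
  refine (cesaroCostInf_le_of_rotSum_le hα hdiss hcont hmin hlam hu
    (R := S.value N x + lam x - (S.Vf (P.x 0) + lam (P.x 0))) fun K => ?_).trans_eq ?_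
  · have h1 := le_value_add hα hdiss hcont hterm hmin hlam hzero (hfeas K) 0
    have h2 := hle K
    rw [rotSum, traj_feedback]
    linarith
  · rw [avgTerminal_eq (lam := lam) fun j => hc j 0]
    congr 1
    ring

/-- Near the orbit the value function differs little from the (constant) rotated terminal cost. -/
lemma value_add_le {γ : ℝ → ℝ} (hγ : ∀ N : ℕ, 1 ≤ N → ∀ x ∈ S.feasible N,
      ∃ i, ‖x - P.x i‖ = P.distX x ∧ |S.value N x - S.value N (P.x i)| ≤ γ (P.distX x))
    {N : ℕ} (hN : 1 ≤ N) (hx : x ∈ S.feasible N) :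
    ∃ i, ‖x - P.x i‖ = P.distX x ∧
      S.value N x + lam x ≤
        S.Vf (P.x 0) + lam (P.x 0) + γ (P.distX x) + (lam x - lam (P.x i)) := by
  have hb := bddBelow_cost hα hdiss hcont hterm hmin hlam hzero
  obtain ⟨i, hi, habs⟩ := hγ N hN x hx
  have h1 := (value_le_terminal hb hterm hzero N (hterm.orbit_mem i)).2
  have h2 := rotTerminal_orbit_eq hα hdiss hcont hterm hmin hlam hzero i 0
  have h3 := (abs_le.1 habs).2
  exact ⟨i, hi, by linarith⟩

lemma exists_bound_value {γ : ℝ → ℝ} (hγK : ClassKInf γ)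
    (hγ : ∀ N : ℕ, 1 ≤ N → ∀ x ∈ S.feasible N,
      ∃ i, ‖x - P.x i‖ = P.distX x ∧ |S.value N x - S.value N (P.x i)| ≤ γ (P.distX x)) :
    ∃ C, ∀ N : ℕ, 1 ≤ N → ∀ x ∈ S.feasible N,
      S.value N x + lam x - (S.Vf (P.x 0) + lam (P.x 0)) ≤ C := by
  have hX := hcont.isCompact_X P
  obtain ⟨B, hB⟩ := (hX.image_of_continuousOn hlam).bddBelow
  obtain ⟨B', hB'⟩ := (hX.image_of_continuousOn hlam).bddAbove
  obtain ⟨D, hD⟩ := hX.isBounded.exists_norm_le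
  refine ⟨γ (D + D) + (B' - B), fun N hN x hx => ?_⟩
  obtain ⟨i, -, hle⟩ := value_add_le hα hdiss hcont hmin hlam hterm hzero hγ hN hx
  have h1 : P.distX x ≤ D + D := (P.distX_le x i).trans
    ((norm_sub_le _ _).trans (add_le_add (hD x hx.1) (hD _ (P.x_mem i))))
  have h2 := hγK.mono (P.distX_nonneg x) h1
  have h3 : lam x ≤ B' := hB' (mem_image_of_mem _ hx.1)
  have h4 : B ≤ lam (P.x i) := hB (mem_image_of_mem _ (P.x_mem i))
  linarith

/-- Turnpike estimate: for long horizons the rotated value function is at most the rotated infinite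
horizon cost plus a small error, uniformly in the initial state and the input sequence. -/
lemma eventually_value_le_rotSum {γ : ℝ → ℝ} (hγK : ClassKInf γ)
    (hγ : ∀ N : ℕ, 1 ≤ N → ∀ x ∈ S.feasible N,
      ∃ i, ‖x - P.x i‖ = P.distX x ∧ |S.value N x - S.value N (P.x i)| ≤ γ (P.distX x))
    (hfeas : FeasibleNear P) {ε : ℝ} (hε : 0 < ε) :
    ∀ᶠ N in atTop, ∀ x ∈ S.feasible N, ∀ u ∈ S.inputsInf x, ∀ R,
      (∀ K, S.rotSum lam K x u ≤ R) →
        S.value N x + lam x - (S.Vf (P.x 0) + lam (P.x 0)) ≤ R + ε := by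
  have hb := bddBelow_cost hα hdiss hcont hterm hmin hlam hzero
  obtain ⟨C, hC⟩ := exists_bound_value hα hdiss hcont hmin hlam hterm hzero hγK hγ
  obtain ⟨L, η, hL, hη, hnear⟩ := hfeas
  obtain ⟨r₁, hr₁, hγr⟩ := hγK.exists_le (half_pos hε)
  have huc := (hcont.isCompact_X P).uniformContinuousOn_of_continuous hlam
  rw [Metric.uniformContinuousOn_iff] at huc
  obtain ⟨r₂, hr₂, hlamr⟩ := huc (ε / 2) (half_pos hε)
  obtain ⟨r, hr, hr1, hr2, hr3⟩ : ∃ r > 0, r ≤ r₁ ∧ r < r₂ ∧ r ≤ η :=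
    ⟨min r₁ (min (r₂ / 2) η), by positivity, min_le_left _ _,
      ((min_le_right _ _).trans (min_le_left _ _)).trans_lt (half_lt_self hr₂),
      (min_le_right _ _).trans (min_le_right _ _)⟩
  -- M steps at distance more than r from the orbit would cost at least M α(r) > C. As M ignores x
  -- and u, the estimate is uniform.
  obtain ⟨M, hM⟩ := exists_nat_gt (C / α r)
  rw [div_lt_iff₀ (hα.pos hr)] at hM
  filter_upwards [eventually_ge_atTop (M + L)] with N hN x hx u hu R hR
  -- A competitor this expensive is beaten by the uniform bound C.
  by_cases hRC : C ≤ R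
  · have := hC N (by omega) x hx
    linarith
  obtain ⟨k, hk, hkr⟩ : ∃ k < M, P.dist (S.traj x u k) (u k) ≤ r := by
    by_contra! hcon
    have h1 : ∑ k ∈ Finset.range M, α r ≤ R :=
      (Finset.sum_le_sum fun k hk => hα.mono hr.le (hcon k (Finset.mem_range.1 hk)).le).trans
        ((sum_dist_le_rotSum hdiss hu M).trans (hR M))
    rw [Finset.sum_const, Finset.card_range, nsmul_eq_mul] at h1
    linarith
  have hdist := (P.distX_le_dist _ _).trans hkr
  -- Since k < M, the remaining horizon is at least L, long enough for feasibility near the orbit.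
  obtain ⟨N', rfl⟩ : ∃ N', N = N' + k := ⟨N - k, by omega⟩
  have hfk : S.traj x u k ∈ S.feasible N' :=
    (value_mono hb hterm hzero (show L ≤ N' by omega) (hnear _ (hu.2 k) (hdist.trans hr3))).1
  have h1 := (feasible_of_traj hb k hu hfk).2
  obtain ⟨i, hi, h2⟩ := value_add_le hα hdiss hcont hmin hlam hterm hzero hγ
    (show 1 ≤ N' by omega) hfk
  have h3 := (hγK.mono (P.distX_nonneg _) (hdist.trans hr1)).trans hγr
  have h4 := hlamr _ (hu.2 k) _ (P.x_mem i) (by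
    rw [dist_eq_norm, hi]
    exact hdist.trans_lt hr2)
  rw [Real.dist_eq] at h4
  have h5 := (le_abs_self _).trans h4.le
  have h6 := hR k
  rw [rotSum] at h6
  linarith

end Performance

end Problem
end EMPC

/-! ### The performance theorem -/

theorem theorem2 {n m p : ℕ} [NeZero p] (S : EMPC.Problem n m) (P : S.PeriodicOrbit p)
    (hopt : P.IsOptimal)
    (hcont : S.ContComp)
    (hdiss : EMPC.Problem.StrictDissipativity P)
    (hterm : EMPC.Problem.TerminalConditions P)
    (hbound : EMPC.Problem.BoundValue P)
    (hmin : P.IsMinimal)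
    (hfeas : EMPC.Problem.FeasibleNear P)
    (hzero : P.avgCost = 0) :
    ∃ δ : ℝ → ℝ, EMPC.ClassL δ ∧ ∀ N : ℕ, 1 ≤ N → ∀ x ∈ S.feasible N,
      (∀ μ : EuclideanSpace ℝ (Fin n) → EuclideanSpace ℝ (Fin m), S.IsOptimalFeedback N μ →
        S.closedLoopCostInf x μ ≤ ((S.value N x - P.avgTerminal : ℝ) : EReal)) ∧
      ((S.value N x - P.avgTerminal : ℝ) : EReal) ≤ S.valueUncInf x + ((δ (N : ℝ) : ℝ) : EReal) := by
  obtain ⟨lam, α, hlam, hα, hdiss⟩ := hdiss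
  simp only [hzero, sub_zero] at hdiss
  obtain ⟨γ, hγK, hγ⟩ := hbound
  obtain ⟨C, hC⟩ :=
    EMPC.Problem.exists_bound_value hα hdiss hcont hmin hlam hterm hzero hγK hγ
  -- All x, u and R are quantified inside Q, so that the error depends on N alone.
  obtain ⟨δ, hδ, hle⟩ := EMPC.exists_classL_of_eventually (C := C)
    (Q := fun N e => 1 ≤ N → ∀ x ∈ S.feasible N, ∀ u ∈ S.inputsInf x, ∀ R,
      (∀ K, S.rotSum lam K x u ≤ R) →
        S.value N x + lam x - (S.Vf (P.x 0) + lam (P.x 0)) ≤ R + e)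
    (fun N a b hab h hN x hx u hu R hR => (h hN x hx u hu R hR).trans (by gcongr))
    (fun N hN x hx u hu R hR => by
      have h0 := hR 0
      rw [EMPC.Problem.rotSum_zero] at h0
      linarith [hC N hN x hx])
    (fun ε hε => (EMPC.Problem.eventually_value_le_rotSum hα hdiss hcont hmin hlam hterm hzero hγK
      hγ hfeas hε).mono fun N hN _ => hN)
  refine ⟨δ, hδ, fun N hN x hx => ⟨fun μ hμ =>
    EMPC.Problem.closedLoopCostInf_le hα hdiss hcont hmin hlam hterm hzero hN hx hμ, ?_⟩⟩
  have hc := EMPC.Problem.rotTerminal_orbit_eq hα hdiss hcont hterm hmin hlam hzero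
  -- With the real number δ(N) on the left, the bound can be checked for each u separately in the
  -- infimum.
  have key : ((S.value N x - P.avgTerminal - δ N : ℝ) : EReal) ≤ S.valueUncInf x := by
    refine le_iInf₂ fun u hu => ?_
    refine le_trans (EReal.coe_le_coe_iff.2 (le_of_eq ?_))
      (EMPC.Problem.le_cesaroCostInf_of_rotSum hα hdiss hcont hmin hlam hu
        (a := S.value N x + lam x - (S.Vf (P.x 0) + lam (P.x 0)) - δ N) fun R hR => ?_)
    · rw [EMPC.Problem.avgTerminal_eq (lam := lam) fun j => hc j 0]
      ring
    · exact sub_le_iff_le_add.2 (hle N hN x hx u hu R hR)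
  calc ((S.value N x - P.avgTerminal : ℝ) : EReal)
      = ((S.value N x - P.avgTerminal - δ N : ℝ) : EReal) + ((δ N : ℝ) : EReal) := by
        rw [← EReal.coe_add, sub_add_cancel]
    _ ≤ S.valueUncInf x + ((δ N : ℝ) : EReal) := by gcongr
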